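/- Let $B=(B(t))_{0\le t\le 1}$ be a standard Brownian motion on a probability space, that is, a centred Gaussian process with $\mathbb{E}[B(s)B(t)]=\min(s,t)$ and almost surely continuous paths. Let $\eta_0(t)=t$ and, for $n\ge 1$ and $1\le i\le 2^{n-1}$, let $\eta_{n,i}$ be the Faber–Schauder function on $[0,1]$ given by $$\eta_{n,i}(t)=\begin{cases}2^{(n-1)/2}\left(t-\frac{2i-2}{2^n}\right), & t\in\left[\frac{2i-2}{2^n},\frac{2i-1}{2^n}\right],\\[2pt] 2^{(n-1)/2}\left(\frac{2i}{2^n}-t\right), & t\in\left[\frac{2i-1}{2^n},\frac{2i}{2^n}\right],\\[2pt] 0,&\text{otherwise.}\end{cases}$$ Let $$B(t)=X_0\,\eta_0(t)+\sum_{n=1}^{\infty}\sum_{i=1}^{2^{n-1}}X_{n,i}\,\eta_{n,i}(t),\qquad 0\le t\le 1,$$ be the Lévy–Ciesielski expansion of $B$, valid almost surely for all $t\in[0,1]$ (its coefficients $X_0$, $X_{n,i}$ are independent standard normal random variables), and for $N\ge 1$ let $$B_N(t)=X_0\,\eta_0(t)+\sum_{n=1}^{N}\sum_{i=1}^{2^{n-1}}X_{n,i}\,\eta_{n,i}(t)$$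 be its truncation at level $N$. Let $r,\sigma,S(0)\in\mathbb{R}$ and, for $0\le t\le 1$, put $$S(t)=S(0)\exp\left(\left(r-\tfrac{\sigma^2}{2}\right)t+\sigma B(t)\right),\qquad S_N(t)=S(0)\exp\left(\left(r-\tfrac{\sigma^2}{2}\right)t+\sigma B_N(t)\right).$$ Write $\|u\|_\infty=\sup_{t\in[0,1]}|u(t)|$ and $d=2^N$. Then there is a constant $C>0$ that depends only on $r$ and $\sigma$ such that, for every $N\ge 1$, the random variable $\|S-S_N\|_\infty$ is integrable and $$\mathbb{E}\left[\|S-S_N\|_\infty\right]\le C\,|S(0)|\,\frac{\sqrt N}{2^{N/2}}\qquad\text{and}\qquad \mathbb{E}\left[\|S-S_N\|_\infty\right]\le C\,|S(0)|\,\sqrt{\frac{\ln d}{d}}.$$ -/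

import Mathlib

open MeasureTheory ProbabilityTheory Filter Topology

noncomputable section

namespace GBM

/-- Standard Brownian motion on `[0,1]`: a centred Gaussian process with
`E[B(s) B(t)] = min(s,t)` and almost surely continuous paths. -/
structure IsStandardBrownianMotion {Ω : Type*} [MeasurableSpace Ω] (B : unitInterval → Ω → ℝ)
    (P : Measure Ω) : Prop where
  gaussian : IsGaussianProcess B P
  mean_zero : ∀ t, ∫ ω, B t ω ∂P = 0
  covariance : ∀ s t, ∫ ω, B s ω * B t ω ∂P = min (s : ℝ) (t : ℝ)
  continuous_paths : ∀ᵐ ω ∂P, Continuous fun t => B t ω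

/-- The Faber-Schauder function `η_{n,i}`, used for `n ≥ 1` and `1 ≤ i ≤ 2 ^ (n - 1)`. -/
def faberSchauder (n i : ℕ) (t : ℝ) : ℝ :=
  if (2 * (i : ℝ) - 2) / 2 ^ n ≤ t ∧ t ≤ (2 * (i : ℝ) - 1) / 2 ^ n then
    (2 : ℝ) ^ (((n : ℝ) - 1) / 2) * (t - (2 * (i : ℝ) - 2) / 2 ^ n)
  else if (2 * (i : ℝ) - 1) / 2 ^ n ≤ t ∧ t ≤ 2 * (i : ℝ) / 2 ^ n then
    (2 : ℝ) ^ (((n : ℝ) - 1) / 2) * (2 * (i : ℝ) / 2 ^ n - t)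
  else 0

/-- The Faber-Schauder series with coefficients `x₀` and `x n i`, truncated at level `N`:
`x₀ η₀(t) + ∑_{n=1}^N ∑_{i=1}^{2^(n-1)} x_{n,i} η_{n,i}(t)`, where `η₀(t) = t`. -/
def truncatedSeries (x₀ : ℝ) (x : ℕ → ℕ → ℝ) (N : ℕ) (t : unitInterval) : ℝ :=
  x₀ * (t : ℝ) +
    ∑ n ∈ Finset.Icc 1 N, ∑ i ∈ Finset.Icc 1 (2 ^ (n - 1)), x n i * faberSchauder n i (t : ℝ)

/-- The random coefficients `X₀`, `X n i` are those of the Lévy-Ciesielski (Faber-Schauder)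
expansion of the process `B`: almost surely, for all `t ∈ [0,1]`,
`B(t) = X₀ η₀(t) + ∑_{n=1}^∞ ∑_{i=1}^{2^(n-1)} X_{n,i} η_{n,i}(t)`.
Nothing is assumed on the law of the coefficients; if `B` is a standard Brownian motion they are
automatically independent standard normal random variables. -/
def IsLevyCiesielskiExpansion {Ω : Type*} [MeasurableSpace Ω] (X₀ : Ω → ℝ) (X : ℕ → ℕ → Ω → ℝ)
    (B : unitInterval → Ω → ℝ) (P : Measure Ω) : Prop :=
  ∀ᵐ ω ∂P, ∀ t : unitInterval,
    Tendsto (fun N => truncatedSeries (X₀ ω) (fun n i => X n i ω) N t) atTop (𝓝 (B t ω))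

/-- `S(t) = S(0) exp((r - σ²/2) t + σ b(t))` for the driving path `b`. -/
def geometric (S₀ r σ : ℝ) (b : unitInterval → ℝ) (t : unitInterval) : ℝ :=
  S₀ * Real.exp ((r - σ ^ 2 / 2) * (t : ℝ) + σ * b t)

/-- The uniform norm on `[0,1]` (of a bounded function). -/
def uniformNorm (u : unitInterval → ℝ) : ℝ := ⨆ t, |u t|

/-- The uniform error `‖S - S_N‖_∞` as a random variable. -/
def uniformError {Ω : Type*} (S₀ r σ : ℝ) (B : unitInterval → Ω → ℝ) (X₀ : Ω → ℝ)
    (X : ℕ → ℕ → Ω → ℝ) (N : ℕ) (ω : Ω) : ℝ :=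
  uniformNorm fun t =>
    geometric S₀ r σ (fun s => B s ω) t -
      geometric S₀ r σ (truncatedSeries (X₀ ω) (fun n i => X n i ω) N) t

end GBM

end

/-
Only the marginal laws of the coefficients matter. If every coefficient of level `n` is at most
`M √n` in absolute value, then, the hat functions of one level having disjoint supports, that level
contributes at most `M √n 2 ^ (-n / 2)` uniformly in `t`. Summing the levels beyond `N` bounds the
uniform distance of the paths by a constant times `M √N 2 ^ (-N / 2)`, and the exponential is
Lipschitz with constant `exp (O(M))` on the range of the paths. It remains to see that `exp (a M)`
has finite expectation for every `a`: choose `ρ` large and let `W` be the sum of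
`ρ ^ (-n) exp (a √n |x|)` over the coefficients `x` of all levels `n`. Then `exp (a M) = ρ W` is
admissible, while `E W` is a convergent geometric series since level `n` has `2 ^ (n - 1)`
sub-Gaussian coefficients.

The coefficients of Brownian motion are its rescaled second differences at dyadic points, hence
standard normal.
-/

noncomputable section

namespace GBM

section Hat

/-- The hat function of height one centred at the integer `c` and vanishing outside
`(c - 1, c + 1)`; all Faber-Schauder functions are rescaled hats with odd centres. -/
def hat (c : ℤ) (u : ℝ) : ℝ := max 0 (1 - |u - c|)

lemma hat_nonneg (c : ℤ) (u : ℝ) : 0 ≤ hat c u := le_max_left _ _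

lemma hat_le_one (c : ℤ) (u : ℝ) : hat c u ≤ 1 :=
  max_le zero_le_one (sub_le_self _ (abs_nonneg _))

@[fun_prop]
lemma continuous_hat (c : ℤ) : Continuous (hat c) := by
  unfold hat
  fun_prop

lemma hat_eq_zero {c : ℤ} {u : ℝ} (h : 1 ≤ |u - c|) : hat c u = 0 :=
  max_eq_left (sub_nonpos.2 h)

lemma hat_of_le_of_le {c : ℤ} {u : ℝ} (h₁ : c - 1 ≤ u) (h₂ : u ≤ c) : hat c u = u - (c - 1) := by
  rw [hat, abs_of_nonpos (by linarith), max_eq_right (by linarith)]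
  ring

lemma hat_of_ge_of_le {c : ℤ} {u : ℝ} (h₁ : c ≤ u) (h₂ : u ≤ c + 1) : hat c u = c + 1 - u := by
  rw [hat, abs_of_nonneg (by linarith), max_eq_right (by linarith)]
  ring

lemma hat_intCast (c k : ℤ) : hat c k = if k = c then 1 else 0 := by
  split_ifs with h
  · simp [hat, h]
  · exact hat_eq_zero (mod_cast Int.one_le_abs (sub_ne_zero.2 h))

lemma hat_eq_interpolation (c p : ℤ) {u : ℝ} (hu : u ∈ Set.Icc (p : ℝ) (p + 1)) :
    hat c u = (p + 1 - u) * hat c p + (u - p) * hat c (p + 1) := by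
  obtain ⟨h₁, h₂⟩ := hu
  rw [show (p : ℝ) + 1 = ((p + 1 : ℤ) : ℝ) by push_cast; rfl, hat_intCast, hat_intCast]
  rcases eq_or_ne p c with rfl | hc
  · simp [hat_of_ge_of_le h₁ h₂]
  rcases eq_or_ne (p + 1) c with rfl | hc'
  · rw [hat_of_le_of_le (by push_cast; linarith) (by push_cast; linarith)]
    simp
  rw [if_neg hc, if_neg hc', mul_zero, mul_zero, add_zero]
  rcases (show c + 1 ≤ p ∨ p + 2 ≤ c by omega) with h | h
  · have h : (c : ℝ) + 1 ≤ p := mod_cast h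
    exact hat_eq_zero (le_abs.2 (.inl (by linarith)))
  · have h : (p : ℝ) + 2 ≤ c := mod_cast h
    exact hat_eq_zero (le_abs.2 (.inr (by linarith)))

lemma hat_midpoint (c p : ℤ) {u v : ℝ} (hu : u ∈ Set.Icc (p : ℝ) (p + 1))
    (hv : v ∈ Set.Icc (p : ℝ) (p + 1)) : hat c ((u + v) / 2) = (hat c u + hat c v) / 2 := by
  have huv : (u + v) / 2 ∈ Set.Icc (p : ℝ) (p + 1) :=
    ⟨by linarith [hu.1, hv.1], by linarith [hu.2, hv.2]⟩
  rw [hat_eq_interpolation c p hu, hat_eq_interpolation c p hv, hat_eq_interpolation c p huv]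
  ring

lemma eq_of_hat_odd_ne_zero {i j : ℕ} {u : ℝ} (hi : hat (2 * i - 1) u ≠ 0)
    (hj : hat (2 * j - 1) u ≠ 0) : i = j := by
  have hi := abs_lt.1 (not_le.1 (mt hat_eq_zero hi))
  have hj := abs_lt.1 (not_le.1 (mt hat_eq_zero hj))
  push_cast at hi hj
  have hij : (i : ℝ) < j + 1 := by linarith [hi.1, hj.2]
  have hji : (j : ℝ) < i + 1 := by linarith [hi.2, hj.1]
  norm_cast at hij hji
  omega

lemma sum_hat_odd_le_one (s : Finset ℕ) (u : ℝ) : ∑ i ∈ s, hat (2 * i - 1) u ≤ 1 := by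
  by_cases! h : ∃ j ∈ s, hat (2 * j - 1) u ≠ 0
  · obtain ⟨j, hj, hju⟩ := h
    rw [Finset.sum_eq_single_of_mem j hj fun i _ hij =>
      not_not.1 fun hiu => hij (eq_of_hat_odd_ne_zero hiu hju)]
    exact hat_le_one _ _
  · exact (Finset.sum_eq_zero h).trans_le zero_le_one

end Hat

section FaberSchauder

lemma two_rpow_half (x : ℝ) : (2 : ℝ) ^ (x / 2) = √2 ^ x := by
  rw [Real.sqrt_eq_rpow, ← Real.rpow_mul zero_le_two, one_div_mul_eq_div]

lemma two_pow_eq_sqrt_two_pow_sq (n : ℕ) : (2 : ℝ) ^ n = (√2 ^ n) ^ 2 := by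
  rw [pow_right_comm, Real.sq_sqrt zero_le_two]

lemma faberSchauder_eq (n i : ℕ) (t : ℝ) :
    faberSchauder n i t = (√2)⁻¹ ^ (n + 1) * hat (2 * i - 1) (2 ^ n * t) := by
  have hamp : (√2)⁻¹ ^ (n + 1) = (2 : ℝ) ^ (((n : ℝ) - 1) / 2) / 2 ^ n := by
    rw [two_rpow_half, Real.rpow_sub_one (by positivity), Real.rpow_natCast,
      two_pow_eq_sqrt_two_pow_sq, inv_pow, pow_succ]
    field_simp
  have hn : (0 : ℝ) < 2 ^ n := by positivity
  rw [hamp]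
  simp only [faberSchauder, div_le_iff₀ hn, le_div_iff₀ hn, mul_comm t]
  split_ifs with h h'
  · rw [hat_of_le_of_le (by push_cast; linarith) (by push_cast; linarith)]
    push_cast
    field_simp
    ring
  · rw [hat_of_ge_of_le (by push_cast; linarith) (by push_cast; linarith)]
    push_cast
    field_simp
    ring
  · rw [hat_eq_zero, mul_zero]
    push_cast
    by_contra! hlt
    obtain ⟨hl, hr⟩ := abs_lt.1 hlt
    rcases le_total (2 ^ n * t) (2 * i - 1) with hle | hle
    · exact h ⟨by linarith, hle⟩
    · exact h' ⟨hle, by linarith⟩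

lemma faberSchauder_dyadic_of_lt {m n : ℕ} (h : n < m) (i k : ℕ) :
    faberSchauder m i (k / 2 ^ n) = 0 := by
  obtain ⟨d, rfl⟩ := Nat.exists_eq_add_of_lt h
  have hk : (2 : ℝ) ^ (n + d + 1) * (k / 2 ^ n) = ((2 * (2 ^ d * k) : ℤ) : ℝ) := by
    push_cast
    field_simp
    ring
  rw [faberSchauder_eq, hk, hat_intCast, if_neg (by omega), mul_zero]

lemma faberSchauder_succ_dyadic (n i j : ℕ) :
    faberSchauder (n + 1) i ((2 * j + 1 : ℕ) / 2 ^ (n + 1)) =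
      if i = j + 1 then (√2)⁻¹ ^ (n + 2) else 0 := by
  have hj : (2 : ℝ) ^ (n + 1) * ((2 * j + 1 : ℕ) / 2 ^ (n + 1)) = ((2 * j + 1 : ℤ) : ℝ) := by
    rw [mul_div_cancel₀ _ (by positivity)]
    push_cast
    rfl
  rw [faberSchauder_eq, hj, hat_intCast, mul_ite, mul_one, mul_zero]
  exact if_congr (by omega) rfl rfl

lemma faberSchauder_midpoint {m n : ℕ} (h : m ≤ n) (i j : ℕ) :
    faberSchauder m i ((j / 2 ^ n + (j + 1 : ℕ) / 2 ^ n) / 2) =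
      (faberSchauder m i (j / 2 ^ n) + faberSchauder m i ((j + 1 : ℕ) / 2 ^ n)) / 2 := by
  obtain ⟨d, rfl⟩ := Nat.exists_eq_add_of_le h
  have hscale (k : ℕ) : (2 : ℝ) ^ m * (k / 2 ^ (m + d)) = k / 2 ^ d := by
    rw [pow_add]
    field_simp
  have hd : (0 : ℝ) < 2 ^ d := by positivity
  have hlow : (j / 2 ^ d : ℕ) * 2 ^ d ≤ j := Nat.div_mul_le_self j _
  have hupp : j + 1 ≤ (j / 2 ^ d + 1) * 2 ^ d := by
    rw [mul_comm]
    exact Nat.lt_mul_div_succ j (by positivity)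
  have hu : (j : ℝ) / 2 ^ d ∈ Set.Icc (((j / 2 ^ d : ℕ) : ℤ) : ℝ) ((j / 2 ^ d : ℕ) + 1) := by
    rw [Set.mem_Icc, le_div_iff₀ hd, div_le_iff₀ hd]
    exact ⟨mod_cast hlow, mod_cast by omega⟩
  have hv : ((j + 1 : ℕ) : ℝ) / 2 ^ d ∈
      Set.Icc (((j / 2 ^ d : ℕ) : ℤ) : ℝ) ((j / 2 ^ d : ℕ) + 1) := by
    rw [Set.mem_Icc, le_div_iff₀ hd, div_le_iff₀ hd]
    exact ⟨mod_cast by omega, mod_cast hupp⟩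
  rw [faberSchauder_eq, faberSchauder_eq, faberSchauder_eq, ← mul_div_assoc, mul_add, hscale,
    hscale, hat_midpoint _ _ hu hv]
  ring

end FaberSchauder

section Dyadic

/-- The dyadic point `k / 2 ^ n` of the unit interval; it is projected to `1` when `2 ^ n < k`. -/
def dyadic (n k : ℕ) : unitInterval := Set.projIcc 0 1 zero_le_one (k / 2 ^ n)

lemma coe_dyadic {n k : ℕ} (h : k ≤ 2 ^ n) : (dyadic n k : ℝ) = k / 2 ^ n := by
  have hk : (k : ℝ) ≤ 2 ^ n := mod_cast h
  rw [dyadic, Set.projIcc_of_mem zero_le_one ⟨by positivity, div_le_one_of_le₀ hk (by positivity)⟩]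

lemma dyadic_zero_one : dyadic 0 1 = 1 := by
  ext
  simp [coe_dyadic]

lemma coe_dyadic_midpoint {n j : ℕ} (hj : j < 2 ^ n) :
    (dyadic (n + 1) (2 * j + 1) : ℝ) = (dyadic n j + dyadic n (j + 1)) / 2 := by
  rw [coe_dyadic hj.le, coe_dyadic hj, coe_dyadic (by rw [pow_succ]; omega)]
  push_cast
  field_simp
  ring

variable (x₀ : ℝ) (x : ℕ → ℕ → ℝ)

lemma truncatedSeries_zero (t : unitInterval) : truncatedSeries x₀ x 0 t = x₀ * t := by
  simp [truncatedSeries]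

lemma truncatedSeries_succ (N : ℕ) (t : unitInterval) :
    truncatedSeries x₀ x (N + 1) t = truncatedSeries x₀ x N t +
      ∑ i ∈ Finset.Icc 1 (2 ^ N), x (N + 1) i * faberSchauder (N + 1) i t := by
  simp only [truncatedSeries, Finset.sum_Icc_succ_top N.succ_pos, add_assoc, Nat.add_sub_cancel]

lemma continuous_truncatedSeries (N : ℕ) : Continuous (truncatedSeries x₀ x N) := by
  unfold truncatedSeries
  simp only [faberSchauder_eq]
  fun_prop

lemma truncatedSeries_dyadic {n N k : ℕ} (hk : k ≤ 2 ^ n) (h : n ≤ N) :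
    truncatedSeries x₀ x N (dyadic n k) = truncatedSeries x₀ x n (dyadic n k) := by
  induction N, h using Nat.le_induction with
  | base => rfl
  | succ N h ih =>
    simp only [truncatedSeries_succ, ih, coe_dyadic hk,
      faberSchauder_dyadic_of_lt (Nat.lt_succ_of_le h), mul_zero, Finset.sum_const_zero, add_zero]

lemma truncatedSeries_midpoint {n j : ℕ} (hj : j < 2 ^ n) :
    truncatedSeries x₀ x n (dyadic (n + 1) (2 * j + 1)) =
      (truncatedSeries x₀ x n (dyadic n j) + truncatedSeries x₀ x n (dyadic n (j + 1))) / 2 := by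
  have hmid : ∀ m ∈ Finset.Icc 1 n, ∀ i, faberSchauder m i (dyadic (n + 1) (2 * j + 1)) =
      (faberSchauder m i (dyadic n j) + faberSchauder m i (dyadic n (j + 1))) / 2 := by
    intro m hm i
    rw [coe_dyadic_midpoint hj, coe_dyadic hj.le, coe_dyadic hj]
    exact faberSchauder_midpoint (Finset.mem_Icc.1 hm).2 i j
  unfold truncatedSeries
  rw [Finset.sum_congr rfl fun m hm => Finset.sum_congr rfl fun i _ => by rw [hmid m hm i],
    add_add_add_comm, ← Finset.sum_add_distrib, add_div, coe_dyadic_midpoint hj]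
  simp only [← Finset.sum_add_distrib, Finset.sum_div, ← mul_add, mul_div_assoc]

variable {x₀ x}

lemma eq_truncatedSeries_dyadic_of_tendsto {n k : ℕ} {y : ℝ} (hk : k ≤ 2 ^ n)
    (hy : Tendsto (truncatedSeries x₀ x · (dyadic n k)) atTop (𝓝 y)) :
    y = truncatedSeries x₀ x n (dyadic n k) := by
  refine tendsto_nhds_unique hy (tendsto_const_nhds.congr' ?_)
  filter_upwards [eventually_ge_atTop n] with N hN
  exact (truncatedSeries_dyadic x₀ x hk hN).symm

lemma coefficient_zero_eq {y : ℝ} (hy : Tendsto (truncatedSeries x₀ x · 1) atTop (𝓝 y)) :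
    x₀ = y := by
  rw [← dyadic_zero_one] at hy
  rw [eq_truncatedSeries_dyadic_of_tendsto (pow_zero 2).ge hy, truncatedSeries_zero,
    dyadic_zero_one, Set.Icc.coe_one, mul_one]

lemma coefficient_succ_eq {b : unitInterval → ℝ}
    (hb : ∀ t, Tendsto (truncatedSeries x₀ x · t) atTop (𝓝 (b t))) {n j : ℕ} (hj : j < 2 ^ n) :
    x (n + 1) (j + 1) = √2 ^ (n + 2) *
      (b (dyadic (n + 1) (2 * j + 1)) - 2⁻¹ * (b (dyadic n j) + b (dyadic n (j + 1)))) := by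
  have hk : 2 * j + 1 ≤ 2 ^ (n + 1) := by rw [pow_succ]; omega
  have hlevel : ∑ i ∈ Finset.Icc 1 (2 ^ n),
      x (n + 1) i * faberSchauder (n + 1) i (dyadic (n + 1) (2 * j + 1)) =
        x (n + 1) (j + 1) * (√2)⁻¹ ^ (n + 2) := by
    simp only [coe_dyadic hk, faberSchauder_succ_dyadic, mul_ite, mul_zero, Finset.sum_ite_eq',
      Finset.mem_Icc]
    rw [if_pos ⟨by omega, hj⟩]
  rw [eq_truncatedSeries_dyadic_of_tendsto hk (hb _),
    eq_truncatedSeries_dyadic_of_tendsto hj.le (hb _),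
    eq_truncatedSeries_dyadic_of_tendsto hj (hb _), truncatedSeries_succ,
    truncatedSeries_midpoint x₀ x hj, hlevel, inv_pow]
  field_simp
  ring

end Dyadic

section SqrtGrowth

lemma inv_sqrt_two_lt_one : (√2)⁻¹ < 1 :=
  inv_lt_one_of_one_lt₀ Real.one_lt_sqrt_two

/-- The rate `√(n + 1) 2 ^ (-n / 2)` at which level `n + 1` of a Faber-Schauder series decays when
its coefficients are `O(√(n + 1))`. -/
def levelRate (n : ℕ) : ℝ := √((n : ℝ) + 1) * (√2)⁻¹ ^ n

/-- The constant `∑ j, (j + 1) 2 ^ (-j / 2)`, which bounds the sum of the decay rates of all levels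
beyond a given one, relative to the first of them. -/
def tailConst : ℝ := ∑' j : ℕ, ((j : ℝ) + 1) * (√2)⁻¹ ^ j

lemma summable_tailConst : Summable fun j : ℕ => ((j : ℝ) + 1) * (√2)⁻¹ ^ j := by
  have hq : ‖(√2)⁻¹‖ < 1 := by
    rw [Real.norm_of_nonneg (by positivity)]
    exact inv_sqrt_two_lt_one
  simpa only [pow_one, add_mul, one_mul] using
    (summable_pow_mul_geometric_of_norm_lt_one 1 hq).add (summable_geometric_of_norm_lt_one hq)

lemma tailConst_nonneg : 0 ≤ tailConst :=
  tsum_nonneg fun _ => by positivity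

lemma levelRate_nonneg (n : ℕ) : 0 ≤ levelRate n := by
  unfold levelRate
  positivity

lemma levelRate_le_one (n : ℕ) : levelRate n ≤ 1 := by
  have hn : √((n : ℝ) + 1) ≤ √2 ^ n := by
    rw [Real.sqrt_le_left (by positivity), ← two_pow_eq_sqrt_two_pow_sq]
    exact_mod_cast Nat.lt_two_pow_self
  rw [levelRate, inv_pow, ← div_eq_mul_inv]
  exact div_le_one_of_le₀ hn (by positivity)

lemma levelRate_add_le (n j : ℕ) :
    levelRate (n + j) ≤ levelRate n * (((j : ℝ) + 1) * (√2)⁻¹ ^ j) := by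
  have hsqrt : √(((n + j : ℕ) : ℝ) + 1) ≤ √((n : ℝ) + 1) * ((j : ℝ) + 1) := by
    rw [Real.sqrt_le_left (by positivity), mul_pow, Real.sq_sqrt (by positivity)]
    push_cast
    nlinarith [mul_nonneg n.cast_nonneg j.cast_nonneg (α := ℝ), sq_nonneg (j : ℝ),
      mul_nonneg n.cast_nonneg (sq_nonneg (j : ℝ)) (α := ℝ)]
  calc levelRate (n + j) ≤ √((n : ℝ) + 1) * ((j : ℝ) + 1) * (√2)⁻¹ ^ (n + j) :=
        mul_le_mul_of_nonneg_right hsqrt (by positivity)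
    _ = levelRate n * (((j : ℝ) + 1) * (√2)⁻¹ ^ j) := by
        rw [levelRate, pow_add]
        ring

lemma tendsto_levelRate : Tendsto levelRate atTop (𝓝 0) := by
  refine squeeze_zero levelRate_nonneg (fun n => ?_) summable_tailConst.tendsto_atTop_zero
  simp [levelRate]

lemma levelRate_le {n : ℕ} (hn : 1 ≤ n) : levelRate n ≤ 2 * (√n / (2 : ℝ) ^ ((n : ℝ) / 2)) := by
  have hn : (1 : ℝ) ≤ n := mod_cast hn
  have hsqrt : √((n : ℝ) + 1) ≤ 2 * √n := by
    rw [Real.sqrt_le_left (by positivity), mul_pow, Real.sq_sqrt (by positivity)]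
    linarith
  rw [levelRate, two_rpow_half, Real.rpow_natCast, inv_pow, ← div_eq_mul_inv, ← mul_div_assoc]
  gcongr

/-- The coefficients of level `n` of a Faber-Schauder series are bounded by `M √n`, and the
coefficient of `η₀` by `M`. -/
structure HasSqrtGrowth (x₀ : ℝ) (x : ℕ → ℕ → ℝ) (M : ℝ) : Prop where
  zero : |x₀| ≤ M
  succ : ∀ n, ∀ i ∈ Finset.Icc 1 (2 ^ n), |x (n + 1) i| ≤ M * √((n : ℝ) + 1)

variable {x₀ : ℝ} {x : ℕ → ℕ → ℝ} {M : ℝ} {b : unitInterval → ℝ}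

namespace HasSqrtGrowth

lemma nonneg (h : HasSqrtGrowth x₀ x M) : 0 ≤ M := (abs_nonneg _).trans h.zero

lemma dist_truncatedSeries_succ_le (h : HasSqrtGrowth x₀ x M) (n : ℕ) (t : unitInterval) :
    dist (truncatedSeries x₀ x n t) (truncatedSeries x₀ x (n + 1) t) ≤ M * levelRate n := by
  have hM := h.nonneg
  rw [dist_comm, Real.dist_eq, truncatedSeries_succ, add_sub_cancel_left]
  calc |∑ i ∈ Finset.Icc 1 (2 ^ n), x (n + 1) i * faberSchauder (n + 1) i t|
      ≤ ∑ i ∈ Finset.Icc (1 : ℕ) (2 ^ n), M * √((n : ℝ) + 1) *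
          ((√2)⁻¹ ^ (n + 2) * hat (2 * i - 1) (2 ^ (n + 1) * t)) := by
        refine (Finset.abs_sum_le_sum_abs _ _).trans (Finset.sum_le_sum fun i hi => ?_)
        rw [abs_mul, faberSchauder_eq, abs_of_nonneg (mul_nonneg (by positivity) (hat_nonneg _ _))]
        exact mul_le_mul_of_nonneg_right (h.succ n i hi)
          (mul_nonneg (by positivity) (hat_nonneg _ _))
    _ = M * √((n : ℝ) + 1) * (√2)⁻¹ ^ (n + 2) *
          ∑ i ∈ Finset.Icc (1 : ℕ) (2 ^ n), hat (2 * i - 1) (2 ^ (n + 1) * t) := by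
        simp only [Finset.mul_sum, mul_assoc]
    _ ≤ M * √((n : ℝ) + 1) * (√2)⁻¹ ^ (n + 2) :=
        mul_le_of_le_one_right (by positivity) (sum_hat_odd_le_one _ _)
    _ ≤ M * √((n : ℝ) + 1) * (√2)⁻¹ ^ n := by
        gcongr _ * ?_
        exact pow_le_pow_of_le_one (by positivity) inv_sqrt_two_lt_one.le (by omega)
    _ = M * levelRate n := mul_assoc _ _ _

lemma dist_truncatedSeries_le (h : HasSqrtGrowth x₀ x M) {t : unitInterval}
    (hb : Tendsto (truncatedSeries x₀ x · t) atTop (𝓝 (b t))) (N : ℕ) :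
    dist (truncatedSeries x₀ x N t) (b t) ≤ M * levelRate N * tailConst := by
  have hstep (j : ℕ) : dist (truncatedSeries x₀ x (j + N) t) (truncatedSeries x₀ x (j + 1 + N) t) ≤
      M * levelRate N * (((j : ℝ) + 1) * (√2)⁻¹ ^ j) := by
    rw [add_right_comm, mul_assoc]
    refine (h.dist_truncatedSeries_succ_le (j + N) t).trans ?_
    rw [add_comm j N]
    exact mul_le_mul_of_nonneg_left (levelRate_add_le N j) h.nonneg
  have := dist_le_tsum_of_dist_le_of_tendsto₀ _ hstep (summable_tailConst.mul_left _)
    ((tendsto_add_atTop_iff_nat N).2 hb)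
  rwa [zero_add, tsum_mul_left] at this

lemma continuous_limit (h : HasSqrtGrowth x₀ x M)
    (hb : ∀ t, Tendsto (truncatedSeries x₀ x · t) atTop (𝓝 (b t))) : Continuous b := by
  have hrate : Tendsto (fun N => M * levelRate N * tailConst) atTop (𝓝 0) := by
    simpa using (tendsto_levelRate.const_mul M).mul_const tailConst
  have hunif : TendstoUniformly (truncatedSeries x₀ x) b atTop := by
    refine Metric.tendstoUniformly_iff.2 fun ε hε => ?_
    filter_upwards [hrate.eventually_lt_const hε] with N hN t
    rw [dist_comm]
    exact (h.dist_truncatedSeries_le (hb t) N).trans_lt hN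
  exact hunif.continuous (Frequently.of_forall (continuous_truncatedSeries x₀ x))

lemma abs_limit_le (h : HasSqrtGrowth x₀ x M) {t : unitInterval}
    (hb : Tendsto (truncatedSeries x₀ x · t) atTop (𝓝 (b t))) : |b t| ≤ M * (1 + tailConst) := by
  have h₀ : |x₀ * t| ≤ M := by
    rw [abs_mul, abs_of_nonneg t.2.1]
    exact (mul_le_of_le_one_right (abs_nonneg _) t.2.2).trans h.zero
  have hdist := h.dist_truncatedSeries_le hb 0
  have htri := abs_sub_abs_le_abs_sub (b t) (truncatedSeries x₀ x 0 t)
  rw [dist_comm, Real.dist_eq] at hdist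
  rw [truncatedSeries_zero] at htri hdist
  have hrate : levelRate 0 = 1 := by simp [levelRate]
  rw [hrate] at hdist
  linarith

lemma abs_truncatedSeries_le (h : HasSqrtGrowth x₀ x M) {t : unitInterval}
    (hb : Tendsto (truncatedSeries x₀ x · t) atTop (𝓝 (b t))) (N : ℕ) :
    |truncatedSeries x₀ x N t| ≤ M * (1 + 2 * tailConst) := by
  have hdist := h.dist_truncatedSeries_le hb N
  have hrate : M * levelRate N * tailConst ≤ M * tailConst :=
    mul_le_mul_of_nonneg_right (mul_le_of_le_one_right h.nonneg (levelRate_le_one N))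
      tailConst_nonneg
  have htri := abs_sub_abs_le_abs_sub (truncatedSeries x₀ x N t) (b t)
  rw [Real.dist_eq] at hdist
  linarith [h.abs_limit_le hb]

end HasSqrtGrowth

end SqrtGrowth

section Geometric

lemma continuous_geometric {b : unitInterval → ℝ} (hb : Continuous b) (S₀ r σ : ℝ) :
    Continuous (geometric S₀ r σ b) := by
  unfold geometric
  fun_prop

lemma abs_exp_sub_exp_le {a b c : ℝ} (ha : a ≤ c) (hb : b ≤ c) :
    |Real.exp a - Real.exp b| ≤ Real.exp c * |a - b| := by
  have hderiv : ∀ u ∈ Set.Iic c, ‖deriv Real.exp u‖ ≤ Real.exp c := fun u hu => by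
    rw [Real.deriv_exp, Real.norm_of_nonneg (Real.exp_pos u).le]
    exact Real.exp_le_exp.2 hu
  exact (convex_Iic c).norm_image_sub_le_of_norm_deriv_le
    (fun u _ => Real.differentiableAt_exp) hderiv hb ha

lemma abs_geometric_sub_le {b b' : unitInterval → ℝ} {t : unitInterval} {R : ℝ} (hb : |b t| ≤ R)
    (hb' : |b' t| ≤ R) (S₀ r σ : ℝ) :
    |geometric S₀ r σ b t - geometric S₀ r σ b' t| ≤
      |S₀| * (Real.exp (|r - σ ^ 2 / 2| + |σ| * R) * (|σ| * |b t - b' t|)) := by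
  have hexponent {y : ℝ} (hy : |y| ≤ R) :
      (r - σ ^ 2 / 2) * t + σ * y ≤ |r - σ ^ 2 / 2| + |σ| * R := by
    refine add_le_add ((le_abs_self _).trans ?_) ((le_abs_self _).trans ?_)
    · rw [abs_mul, abs_of_nonneg t.2.1]
      exact mul_le_of_le_one_right (abs_nonneg _) t.2.2
    · rw [abs_mul]
      gcongr
  rw [geometric, geometric, ← mul_sub, abs_mul, ← abs_mul σ, mul_sub σ,
    ← add_sub_add_left_eq_sub (σ * b t) _ ((r - σ ^ 2 / 2) * t)]
  gcongr
  exact abs_exp_sub_exp_le (hexponent hb) (hexponent hb')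

lemma HasSqrtGrowth.uniformNorm_geometric_sub_le {x₀ : ℝ} {x : ℕ → ℕ → ℝ} {M : ℝ}
    {b : unitInterval → ℝ} (h : HasSqrtGrowth x₀ x M)
    (hb : ∀ t, Tendsto (truncatedSeries x₀ x · t) atTop (𝓝 (b t))) (S₀ r σ : ℝ) (N : ℕ) :
    uniformNorm (fun t => geometric S₀ r σ b t - geometric S₀ r σ (truncatedSeries x₀ x N) t) ≤
      |S₀| * (Real.exp (|r - σ ^ 2 / 2|) * Real.exp (|σ| * (1 + 3 * tailConst) * M) *
        levelRate N) := by
  have hM := h.nonneg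
  have hK := tailConst_nonneg
  have hrate := levelRate_nonneg N
  refine ciSup_le fun t => (abs_geometric_sub_le (R := M * (1 + 2 * tailConst))
    ((h.abs_limit_le (hb t)).trans (by gcongr; linarith))
    (h.abs_truncatedSeries_le (hb t) N) S₀ r σ).trans ?_
  gcongr |S₀| * ?_
  have hdist : |b t - truncatedSeries x₀ x N t| ≤ M * levelRate N * tailConst := by
    rw [abs_sub_comm]
    exact h.dist_truncatedSeries_le (hb t) N
  have hexp : |σ| * M * tailConst ≤ Real.exp (|σ| * M * tailConst) :=
    (le_add_of_nonneg_right zero_le_one).trans (Real.add_one_le_exp _)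
  calc Real.exp (|r - σ ^ 2 / 2| + |σ| * (M * (1 + 2 * tailConst))) *
        (|σ| * |b t - truncatedSeries x₀ x N t|)
      ≤ Real.exp (|r - σ ^ 2 / 2| + |σ| * (M * (1 + 2 * tailConst))) *
        (|σ| * (M * levelRate N * tailConst)) := by gcongr
    _ = Real.exp (|r - σ ^ 2 / 2| + |σ| * (M * (1 + 2 * tailConst))) * (|σ| * M * tailConst) *
        levelRate N := by ring
    _ ≤ Real.exp (|r - σ ^ 2 / 2| + |σ| * (M * (1 + 2 * tailConst))) *
        Real.exp (|σ| * M * tailConst) * levelRate N := by gcongr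
    _ = Real.exp (|r - σ ^ 2 / 2|) * Real.exp (|σ| * (1 + 3 * tailConst) * M) * levelRate N := by
        rw [← Real.exp_add, ← Real.exp_add]
        ring_nf

end Geometric

section ExponentialWeight

open scoped ENNReal NNReal

/-- The sum over all levels `n` of `ρ ^ (-n) exp (a √n |x|)`, where `x` runs over the coefficients
of level `n` of a Faber-Schauder series; `η₀` contributes `exp (a |x₀|)`. Its finiteness controls
the growth of the coefficients; it takes values in `[0, ∞]` so that it can be integrated termwise
when the coefficients are random. -/
def weightedExpSum (a ρ x₀ : ℝ) (x : ℕ → ℕ → ℝ) : ℝ≥0∞ :=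
  ENNReal.ofReal (Real.exp (a * |x₀|)) + ∑' n : ℕ, ∑ i ∈ Finset.Icc 1 (2 ^ n),
    ENNReal.ofReal (Real.exp (a * (√((n : ℝ) + 1) * |x (n + 1) i|)) / ρ ^ (n + 1))

section Deterministic

variable {a ρ x₀ : ℝ} {x : ℕ → ℕ → ℝ}

lemma exp_zero_le_weightedExpSum (hW : weightedExpSum a ρ x₀ x ≠ ∞) :
    Real.exp (a * |x₀|) ≤ (weightedExpSum a ρ x₀ x).toReal :=
  (ENNReal.ofReal_le_iff_le_toReal hW).1 le_self_add

lemma exp_succ_div_le_weightedExpSum (hW : weightedExpSum a ρ x₀ x ≠ ∞) {n i : ℕ}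
    (hi : i ∈ Finset.Icc 1 (2 ^ n)) :
    Real.exp (a * (√((n : ℝ) + 1) * |x (n + 1) i|)) / ρ ^ (n + 1) ≤
      (weightedExpSum a ρ x₀ x).toReal := by
  refine (ENNReal.ofReal_le_iff_le_toReal hW).1 (le_trans ?_ le_add_self)
  exact (Finset.single_le_sum (f := fun i => ENNReal.ofReal
    (Real.exp (a * (√((n : ℝ) + 1) * |x (n + 1) i|)) / ρ ^ (n + 1)))
    (fun _ _ => zero_le) hi).trans (ENNReal.le_tsum n)

lemma one_le_weightedExpSum (ha : 0 ≤ a) (hW : weightedExpSum a ρ x₀ x ≠ ∞) :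
    1 ≤ (weightedExpSum a ρ x₀ x).toReal :=
  (Real.one_le_exp (by positivity)).trans (exp_zero_le_weightedExpSum hW)

lemma hasSqrtGrowth_log_weightedExpSum (ha : 0 < a) (hρ : 1 ≤ ρ)
    (hW : weightedExpSum a ρ x₀ x ≠ ∞) :
    HasSqrtGrowth x₀ x (Real.log (ρ * (weightedExpSum a ρ x₀ x).toReal) / a) := by
  have hw := one_le_weightedExpSum ha.le hW
  set w := (weightedExpSum a ρ x₀ x).toReal
  have hρw : 0 < ρ * w := by positivity
  constructor
  · rw [le_div_iff₀' ha, Real.le_log_iff_exp_le hρw]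
    exact (exp_zero_le_weightedExpSum hW).trans (le_mul_of_one_le_left (by positivity) hρ)
  · intro n i hi
    have hexp : Real.exp (a * (√((n : ℝ) + 1) * |x (n + 1) i|)) ≤ (ρ * w) ^ (n + 1) := by
      rw [mul_pow]
      refine ((div_le_iff₀' (by positivity)).1 (exp_succ_div_le_weightedExpSum hW hi)).trans ?_
      gcongr
      exact le_self_pow₀ hw n.succ_ne_zero
    have hlog := (Real.le_log_iff_exp_le (by positivity)).2 hexp
    have hsqrt : (0 : ℝ) < √((n : ℝ) + 1) := by positivity
    rw [Real.log_pow, Nat.cast_succ] at hlog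
    nth_rw 2 [← Real.mul_self_sqrt (show (0 : ℝ) ≤ (n : ℝ) + 1 by positivity)] at hlog
    rw [div_mul_eq_mul_div, le_div_iff₀ ha]
    refine le_of_mul_le_mul_left ?_ hsqrt
    linarith

end Deterministic

variable {Ω : Type*} [MeasurableSpace Ω] {P : Measure Ω} {Y X₀ : Ω → ℝ} {X : ℕ → ℕ → Ω → ℝ}
  {c : ℝ≥0}

lemma lintegral_exp_mul_abs_le (hY : HasSubgaussianMGF Y c P) (s : ℝ) :
    ∫⁻ ω, ENNReal.ofReal (Real.exp (s * |Y ω|)) ∂P ≤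
      ENNReal.ofReal (2 * Real.exp (c * s ^ 2 / 2)) := by
  have hint (s : ℝ) := hY.integrable_exp_mul s
  have habs (y : ℝ) : Real.exp (s * |y|) ≤ Real.exp (s * y) + Real.exp (-s * y) := by
    rcases abs_choice y with h | h <;> rw [h]
    · exact le_add_of_nonneg_right (Real.exp_pos _).le
    · rw [mul_neg, ← neg_mul]
      exact le_add_of_nonneg_left (Real.exp_pos _).le
  calc ∫⁻ ω, ENNReal.ofReal (Real.exp (s * |Y ω|)) ∂P
      ≤ ∫⁻ ω, ENNReal.ofReal (Real.exp (s * Y ω) + Real.exp (-s * Y ω)) ∂P :=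
        lintegral_mono fun ω => ENNReal.ofReal_le_ofReal (habs (Y ω))
    _ = ENNReal.ofReal (mgf Y P s + mgf Y P (-s)) := by
        rw [mgf, mgf, ← integral_add (hint s) (hint (-s))]
        exact (ofReal_integral_eq_lintegral_ofReal ((hint s).add (hint (-s)))
          (.of_forall fun ω => (add_pos (Real.exp_pos _) (Real.exp_pos _)).le)).symm
    _ ≤ ENNReal.ofReal (2 * Real.exp (c * s ^ 2 / 2)) := by
        have hneg := hY.mgf_le (-s)
        rw [neg_sq] at hneg
        exact ENNReal.ofReal_le_ofReal (by linarith [hY.mgf_le s])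

/-- A weight base `ρ` for which `weightedExpSum a ρ` has finite expectation when the coefficients
are sub-Gaussian with variance proxy `c`: the factor `exp (c a ^ 2 / 2)` compensates the
exponential moments, the factor `4` the number of coefficients in each level. -/
def weightBase (c : ℝ≥0) (a : ℝ) : ℝ := 4 * Real.exp (c * a ^ 2 / 2)

lemma four_le_weightBase (c : ℝ≥0) (a : ℝ) : 4 ≤ weightBase c a :=
  le_mul_of_one_le_right zero_le_four (Real.one_le_exp (by positivity))

lemma lintegral_exp_sqrt_mul_abs_div_le (hY : HasSubgaussianMGF Y c P) (a : ℝ) (n : ℕ) :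
    ∫⁻ ω, ENNReal.ofReal (Real.exp (a * (√((n : ℝ) + 1) * |Y ω|)) / weightBase c a ^ (n + 1)) ∂P ≤
      ENNReal.ofReal (2 / 4 ^ (n + 1)) := by
  have hρ : 0 ≤ (weightBase c a ^ (n + 1))⁻¹ :=
    inv_nonneg.2 (pow_nonneg (zero_le_four.trans (four_le_weightBase c a)) _)
  simp only [div_eq_mul_inv, ENNReal.ofReal_mul' hρ, ← mul_assoc a]
  rw [lintegral_mul_const' _ _ ENNReal.ofReal_ne_top]
  refine (mul_le_mul_left (lintegral_exp_mul_abs_le hY _) _).trans ?_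
  rw [← ENNReal.ofReal_mul' hρ, mul_pow, Real.sq_sqrt (by positivity), weightBase, mul_pow,
    ← Real.exp_nat_mul]
  refine ENNReal.ofReal_le_ofReal (le_of_eq ?_)
  push_cast
  field_simp

lemma aemeasurable_weightedExpSum_term (hY : AEMeasurable Y P) (a ρ : ℝ) (n : ℕ) :
    AEMeasurable (fun ω => ENNReal.ofReal
      (Real.exp (a * (√((n : ℝ) + 1) * |Y ω|)) / ρ ^ (n + 1))) P := by
  fun_prop

lemma aemeasurable_weightedExpSum (h₀ : AEMeasurable X₀ P)
    (h : ∀ n, ∀ i ∈ Finset.Icc 1 (2 ^ n), AEMeasurable (X (n + 1) i) P) (a ρ : ℝ) :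
    AEMeasurable (fun ω => weightedExpSum a ρ (X₀ ω) fun n i => X n i ω) P := by
  unfold weightedExpSum
  refine AEMeasurable.add (by fun_prop) (.tsum fun n =>
    Finset.aemeasurable_fun_sum _ fun i hi => aemeasurable_weightedExpSum_term (h n i hi) a ρ n)

lemma lintegral_weightedExpSum_level_le {n : ℕ}
    (h : ∀ i ∈ Finset.Icc 1 (2 ^ n), HasSubgaussianMGF (X (n + 1) i) c P) (a : ℝ) :
    ∫⁻ ω, ∑ i ∈ Finset.Icc 1 (2 ^ n), ENNReal.ofReal
      (Real.exp (a * (√((n : ℝ) + 1) * |X (n + 1) i ω|)) / weightBase c a ^ (n + 1)) ∂P ≤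
        2⁻¹ ^ (n + 1) := by
  rw [lintegral_finsetSum' _ fun i hi =>
    aemeasurable_weightedExpSum_term (h i hi).aemeasurable a (weightBase c a) n]
  refine (Finset.sum_le_card_nsmul _ _ _ fun i hi =>
    lintegral_exp_sqrt_mul_abs_div_le (h i hi) a n).trans (le_of_eq ?_)
  rw [Nat.card_Icc, Nat.add_sub_cancel, ← ENNReal.ofReal_nsmul, ← ENNReal.ofReal_ofNat 2,
    ← ENNReal.ofReal_inv_of_pos zero_lt_two, ← ENNReal.ofReal_pow (by positivity), nsmul_eq_mul,
    show (4 : ℝ) = 2 * 2 by norm_num, mul_pow, inv_pow]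
  congr 1
  push_cast
  field_simp
  ring

lemma lintegral_weightedExpSum_le (h₀ : HasSubgaussianMGF X₀ c P)
    (h : ∀ n, ∀ i ∈ Finset.Icc 1 (2 ^ n), HasSubgaussianMGF (X (n + 1) i) c P) (a : ℝ) :
    ∫⁻ ω, weightedExpSum a (weightBase c a) (X₀ ω) (fun n i => X n i ω) ∂P ≤
      ENNReal.ofReal (weightBase c a) := by
  have htail : ∑' n : ℕ, (2⁻¹ : ℝ≥0∞) ^ (n + 1) = ENNReal.ofReal 1 := by
    rw [ENNReal.tsum_geometric_add_one, ENNReal.one_sub_inv_two, inv_inv,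
      ENNReal.inv_mul_cancel two_ne_zero ENNReal.ofNat_ne_top, ENNReal.ofReal_one]
  calc ∫⁻ ω, weightedExpSum a (weightBase c a) (X₀ ω) (fun n i => X n i ω) ∂P
      ≤ ENNReal.ofReal (2 * Real.exp (c * a ^ 2 / 2)) + ∑' n : ℕ, 2⁻¹ ^ (n + 1) := by
        unfold weightedExpSum
        have h₀ₘ := h₀.aemeasurable
        rw [lintegral_add_left' (by fun_prop), lintegral_tsum fun n =>
          Finset.aemeasurable_fun_sum _ fun i hi =>
            aemeasurable_weightedExpSum_term (h n i hi).aemeasurable a (weightBase c a) n]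
        exact add_le_add (lintegral_exp_mul_abs_le h₀ a)
          (ENNReal.tsum_le_tsum fun n => lintegral_weightedExpSum_level_le (h n) a)
    _ ≤ ENNReal.ofReal (weightBase c a) := by
        have hexp : 1 ≤ Real.exp (c * a ^ 2 / 2) := Real.one_le_exp (by positivity)
        rw [htail, ← ENNReal.ofReal_add (by positivity) zero_le_one, weightBase]
        exact ENNReal.ofReal_le_ofReal (by linarith)

end ExponentialWeight

section UniformError

open scoped ENNReal NNReal

lemma uniformNorm_nonneg (u : unitInterval → ℝ) : 0 ≤ uniformNorm u :=
  Real.iSup_nonneg fun _ => abs_nonneg _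

/-- The exponent `a` for which `exp (a M)` dominates the uniform error when the coefficients of the
expansion are `O(M √n)`; the summand `1` makes it positive even if `σ = 0`. -/
def errorExponent (σ : ℝ) : ℝ := |σ| * (1 + 3 * tailConst) + 1

lemma errorExponent_pos (σ : ℝ) : 0 < errorExponent σ := by
  have hK := tailConst_nonneg
  unfold errorExponent
  positivity

lemma uniformNorm_geometric_sub_le_weightedExpSum {ρ x₀ : ℝ} {x : ℕ → ℕ → ℝ}
    {b : unitInterval → ℝ} {σ : ℝ} (hρ : 1 ≤ ρ)
    (hW : weightedExpSum (errorExponent σ) ρ x₀ x ≠ ∞)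
    (hb : ∀ t, Tendsto (truncatedSeries x₀ x · t) atTop (𝓝 (b t))) (S₀ r : ℝ) {N : ℕ}
    (hN : 1 ≤ N) :
    uniformNorm (fun t => geometric S₀ r σ b t - geometric S₀ r σ (truncatedSeries x₀ x N) t) ≤
      2 * Real.exp |r - σ ^ 2 / 2| * ρ * |S₀| * (√N / (2 : ℝ) ^ ((N : ℝ) / 2)) *
        (weightedExpSum (errorExponent σ) ρ x₀ x).toReal := by
  have ha := errorExponent_pos σ
  have hw := one_le_weightedExpSum ha.le hW
  have hgrowth := hasSqrtGrowth_log_weightedExpSum ha hρ hW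
  set w := (weightedExpSum (errorExponent σ) ρ x₀ x).toReal
  set M := Real.log (ρ * w) / errorExponent σ with hM
  have hM₀ := hgrowth.nonneg
  have hexp : Real.exp (|σ| * (1 + 3 * tailConst) * M) ≤ ρ * w :=
    calc Real.exp (|σ| * (1 + 3 * tailConst) * M) ≤ Real.exp (errorExponent σ * M) := by
          gcongr
          exact le_add_of_nonneg_right zero_le_one
      _ = ρ * w := by rw [hM, mul_div_cancel₀ _ ha.ne', Real.exp_log (by positivity)]
  have hrate := levelRate_nonneg N
  calc _ ≤ |S₀| * (Real.exp |r - σ ^ 2 / 2| * Real.exp (|σ| * (1 + 3 * tailConst) * M) *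
        levelRate N) := hgrowth.uniformNorm_geometric_sub_le hb S₀ r σ N
    _ ≤ |S₀| * (Real.exp |r - σ ^ 2 / 2| * (ρ * w) * (2 * (√N / (2 : ℝ) ^ ((N : ℝ) / 2)))) := by
        gcongr
        exact levelRate_le hN
    _ = _ := by ring

variable {Ω : Type*} [MeasurableSpace Ω] {P : Measure Ω}

lemma aemeasurable_uniformNorm {U : unitInterval → Ω → ℝ} (hU : ∀ t, AEMeasurable (U t) P)
    (hcont : ∀ᵐ ω ∂P, Continuous (U · ω)) : AEMeasurable (fun ω => uniformNorm (U · ω)) P := by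
  obtain ⟨s, hs, hdense⟩ := TopologicalSpace.exists_countable_dense unitInterval
  have := hs.to_subtype
  refine (AEMeasurable.iSup fun t : s => (hU t).abs).congr ?_
  filter_upwards [hcont] with ω hω
  exact hdense.ciSup' hω.abs

lemma integrable_and_integral_le_of_le_mul_toReal {f : Ω → ℝ} {W : Ω → ℝ≥0∞} {A ρ : ℝ}
    (hA : 0 ≤ A) (hρ : 0 ≤ ρ) (hf : AEMeasurable f P) (hf₀ : 0 ≤ f) (hW : AEMeasurable W P)
    (hWρ : ∫⁻ ω, W ω ∂P ≤ ENNReal.ofReal ρ) (hfW : ∀ᵐ ω ∂P, f ω ≤ A * (W ω).toReal) :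
    Integrable f P ∧ ∫ ω, f ω ∂P ≤ A * ρ := by
  have hWtop : ∫⁻ ω, W ω ∂P ≠ ∞ := ne_top_of_le_ne_top ENNReal.ofReal_ne_top hWρ
  have hWint : Integrable (fun ω => A * (W ω).toReal) P :=
    (integrable_toReal_of_lintegral_ne_top hW hWtop).const_mul A
  have hfint : Integrable f P := hWint.mono' hf.aestronglyMeasurable <| by
    filter_upwards [hfW] with ω hω
    rwa [Real.norm_of_nonneg (hf₀ ω)]
  refine ⟨hfint, (integral_mono_ae hfint hWint hfW).trans ?_⟩
  rw [integral_const_mul, integral_toReal hW (ae_lt_top' hW hWtop)]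
  exact mul_le_mul_of_nonneg_left (ENNReal.toReal_le_of_le_ofReal hρ hWρ) hA

variable {B : unitInterval → Ω → ℝ} {X₀ : Ω → ℝ} {X : ℕ → ℕ → Ω → ℝ} {c : ℝ≥0}

lemma aemeasurable_truncatedSeries (h₀ : AEMeasurable X₀ P)
    (h : ∀ n, ∀ i ∈ Finset.Icc 1 (2 ^ n), AEMeasurable (X (n + 1) i) P) (N : ℕ)
    (t : unitInterval) :
    AEMeasurable (fun ω => truncatedSeries (X₀ ω) (fun n i => X n i ω) N t) P := by
  induction N with
  | zero =>
    simp only [truncatedSeries_zero]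
    exact h₀.mul_const _
  | succ N ih =>
    simp only [truncatedSeries_succ]
    exact ih.add (Finset.aemeasurable_fun_sum _ fun i hi => (h N i hi).mul_const _)

lemma IsLevyCiesielskiExpansion.aemeasurable (hX : IsLevyCiesielskiExpansion X₀ X B P)
    (h₀ : AEMeasurable X₀ P)
    (h : ∀ n, ∀ i ∈ Finset.Icc 1 (2 ^ n), AEMeasurable (X (n + 1) i) P) (t : unitInterval) :
    AEMeasurable (B t) P :=
  aemeasurable_of_tendsto_metrizable_ae atTop (fun N => aemeasurable_truncatedSeries h₀ h N t)
    (hX.mono fun _ hω => hω t)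

lemma aemeasurable_uniformError (hX : IsLevyCiesielskiExpansion X₀ X B P)
    (hB : ∀ᵐ ω ∂P, Continuous (B · ω)) (h₀ : AEMeasurable X₀ P)
    (h : ∀ n, ∀ i ∈ Finset.Icc 1 (2 ^ n), AEMeasurable (X (n + 1) i) P) (S₀ r σ : ℝ) (N : ℕ) :
    AEMeasurable (uniformError S₀ r σ B X₀ X N) P := by
  refine aemeasurable_uniformNorm (fun t => ?_) ?_
  · have hBt := hX.aemeasurable h₀ h t
    have hBNt := aemeasurable_truncatedSeries h₀ h N t
    unfold geometric
    fun_prop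
  · filter_upwards [hB] with ω hω
    exact (continuous_geometric hω S₀ r σ).sub
      (continuous_geometric (continuous_truncatedSeries _ _ N) S₀ r σ)

/-- The constant of the error bound when the coefficients are sub-Gaussian with variance
proxy `c`. -/
def errorConst (r σ : ℝ) (c : ℝ≥0) : ℝ :=
  2 * Real.exp |r - σ ^ 2 / 2| * weightBase c (errorExponent σ) ^ 2

lemma errorConst_pos (r σ : ℝ) (c : ℝ≥0) : 0 < errorConst r σ c := by
  unfold errorConst weightBase
  positivity

lemma integrable_uniformError_and_integral_le (h₀ : HasSubgaussianMGF X₀ c P)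
    (h : ∀ n, ∀ i ∈ Finset.Icc 1 (2 ^ n), HasSubgaussianMGF (X (n + 1) i) c P)
    (hX : IsLevyCiesielskiExpansion X₀ X B P) (S₀ r σ : ℝ) {N : ℕ} (hN : 1 ≤ N) :
    Integrable (uniformError S₀ r σ B X₀ X N) P ∧
      ∫ ω, uniformError S₀ r σ B X₀ X N ω ∂P ≤
        errorConst r σ c * |S₀| * (√N / (2 : ℝ) ^ ((N : ℝ) / 2)) := by
  have hm₀ := h₀.aemeasurable
  have hm := fun n i hi => (h n i hi).aemeasurable
  set ρ := weightBase c (errorExponent σ) with hρ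
  have hρ₄ : 4 ≤ ρ := four_le_weightBase c _
  have hWm := aemeasurable_weightedExpSum hm₀ hm (errorExponent σ) ρ
  have hWint := lintegral_weightedExpSum_le h₀ h (errorExponent σ)
  have hWfin : ∀ᵐ ω ∂P, weightedExpSum (errorExponent σ) ρ (X₀ ω) (fun n i => X n i ω) ≠ ∞ :=
    (ae_lt_top' hWm (ne_top_of_le_ne_top ENNReal.ofReal_ne_top hWint)).mono fun _ => LT.lt.ne
  have hBcont : ∀ᵐ ω ∂P, Continuous (B · ω) := by
    filter_upwards [hX, hWfin] with ω hb hW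
    exact (hasSqrtGrowth_log_weightedExpSum (errorExponent_pos σ) (by linarith) hW).continuous_limit
      hb
  have hbound : ∀ᵐ ω ∂P, uniformError S₀ r σ B X₀ X N ω ≤
      2 * Real.exp |r - σ ^ 2 / 2| * ρ * |S₀| * (√N / (2 : ℝ) ^ ((N : ℝ) / 2)) *
        (weightedExpSum (errorExponent σ) ρ (X₀ ω) (fun n i => X n i ω)).toReal := by
    filter_upwards [hX, hWfin] with ω hb hW
    exact uniformNorm_geometric_sub_le_weightedExpSum (by linarith) hW hb S₀ r hN
  obtain ⟨hint, hle⟩ := integrable_and_integral_le_of_le_mul_toReal (by positivity) (by linarith)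
    (aemeasurable_uniformError hX hBcont hm₀ hm S₀ r σ N) (fun _ => uniformNorm_nonneg _) hWm hWint
    hbound
  refine ⟨hint, hle.trans_eq ?_⟩
  rw [errorConst, ← hρ]
  ring

end UniformError

lemma sqrt_div_two_rpow_eq (N : ℕ) : √N / (2 : ℝ) ^ ((N : ℝ) / 2) =
    (√(Real.log 2))⁻¹ * √(Real.log ((2 : ℝ) ^ N) / (2 : ℝ) ^ N) := by
  have hlog : √(Real.log 2) ≠ 0 := (Real.sqrt_pos.2 (Real.log_pos one_lt_two)).ne'
  rw [two_rpow_half, Real.rpow_natCast, Real.log_pow, Real.sqrt_div' _ (by positivity),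
    Real.sqrt_mul N.cast_nonneg, two_pow_eq_sqrt_two_pow_sq, Real.sqrt_sq (by positivity)]
  field_simp

section BrownianMotion

variable {Ω : Type*} [MeasurableSpace Ω] {P : Measure Ω} {B : unitInterval → Ω → ℝ}
  {X₀ : Ω → ℝ} {X : ℕ → ℕ → Ω → ℝ}

lemma hasSubgaussianMGF_of_hasGaussianLaw {Z : Ω → ℝ} (hZ : HasGaussianLaw Z P)
    (hmean : P[Z] = 0) : HasSubgaussianMGF Z Var[Z; P].toNNReal P := by
  have hmap := hZ.map_eq_gaussianReal
  rw [hmean] at hmap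
  rw [← HasSubgaussianMGF.id_map_iff hZ.aemeasurable, hmap]
  refine ⟨integrable_exp_mul_gaussianReal, fun t => ?_⟩
  simp only [mgf_id_gaussianReal, zero_mul, zero_add, le_refl]

namespace IsStandardBrownianMotion

lemma covariance_eq_min (hB : IsStandardBrownianMotion B P) (s t : unitInterval) :
    cov[B s, B t; P] = min (s : ℝ) t := by
  have := hB.gaussian.isProbabilityMeasure
  rw [covariance_eq_sub (hB.gaussian.hasGaussianLaw_eval s).memLp_two
    (hB.gaussian.hasGaussianLaw_eval t).memLp_two, hB.mean_zero, zero_mul, sub_zero]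
  exact hB.covariance s t

lemma variance_eq (hB : IsStandardBrownianMotion B P) (t : unitInterval) :
    Var[B t; P] = t := by
  rw [← covariance_self (hB.gaussian.aemeasurable t), hB.covariance_eq_min, min_self]

lemma hasGaussianLaw_secondDifference (hB : IsStandardBrownianMotion B P)
    (l m r : unitInterval) : HasGaussianLaw (B m - (2⁻¹ : ℝ) • (B l + B r)) P := by
  let eval (t : unitInterval) (ht : t ∈ ({l, m, r} : Finset unitInterval)) :
      (({l, m, r} : Finset unitInterval) → ℝ) →L[ℝ] ℝ := .proj ⟨t, ht⟩
  exact (hB.gaussian.hasGaussianLaw {l, m, r}).map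
    (eval m (by simp) - (2⁻¹ : ℝ) • (eval l (by simp) + eval r (by simp)))

lemma integral_secondDifference (hB : IsStandardBrownianMotion B P) (l m r : unitInterval) :
    P[B m - (2⁻¹ : ℝ) • (B l + B r)] = 0 := by
  have hint (t : unitInterval) : Integrable (B t) P :=
    (hB.gaussian.hasGaussianLaw_eval t).integrable
  rw [integral_sub' (hint m) (((hint l).add (hint r)).smul _)]
  simp only [Pi.smul_apply, integral_smul, integral_add' (hint l) (hint r), hB.mean_zero, add_zero,
    smul_zero, sub_zero]

lemma variance_secondDifference (hB : IsStandardBrownianMotion B P) {l m r : unitInterval}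
    (hlr : l ≤ r) (hm : (m : ℝ) = (l + r) / 2) :
    Var[B m - (2⁻¹ : ℝ) • (B l + B r); P] = ((r : ℝ) - l) / 4 := by
  have := hB.gaussian.isProbabilityMeasure
  have hL2 (t : unitInterval) : MemLp (B t) 2 P := (hB.gaussian.hasGaussianLaw_eval t).memLp_two
  have hlr : (l : ℝ) ≤ r := hlr
  rw [variance_sub (hL2 m) (((hL2 l).add (hL2 r)).const_smul _), covariance_smul_right,
    covariance_add_right (hL2 m) (hL2 l) (hL2 r), variance_smul, variance_add (hL2 l) (hL2 r)]
  simp only [hB.variance_eq, hB.covariance_eq_min]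
  rw [min_eq_right (by linarith : (l : ℝ) ≤ m), min_eq_left (by linarith : (m : ℝ) ≤ r),
    min_eq_left hlr]
  linarith

end IsStandardBrownianMotion

namespace IsLevyCiesielskiExpansion

lemma hasSubgaussianMGF_zero (hX : IsLevyCiesielskiExpansion X₀ X B P)
    (hB : IsStandardBrownianMotion B P) : HasSubgaussianMGF X₀ 1 P := by
  have hB₁ := hasSubgaussianMGF_of_hasGaussianLaw (hB.gaussian.hasGaussianLaw_eval 1)
    (hB.mean_zero 1)
  rw [hB.variance_eq, Set.Icc.coe_one, Real.toNNReal_one] at hB₁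
  exact hB₁.congr (hX.mono fun _ hω => (coefficient_zero_eq (hω 1)).symm)

lemma hasSubgaussianMGF_succ (hX : IsLevyCiesielskiExpansion X₀ X B P)
    (hB : IsStandardBrownianMotion B P) (n i : ℕ) (hi : i ∈ Finset.Icc 1 (2 ^ n)) :
    HasSubgaussianMGF (X (n + 1) i) 1 P := by
  obtain ⟨j, rfl⟩ := Nat.exists_eq_add_of_le' (Finset.mem_Icc.1 hi).1
  have hj : j < 2 ^ n := (Finset.mem_Icc.1 hi).2
  set l := dyadic n j
  set m := dyadic (n + 1) (2 * j + 1)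
  set r := dyadic n (j + 1)
  have hlr : (r : ℝ) - l = (2 ^ n)⁻¹ := by
    rw [coe_dyadic hj, coe_dyadic hj.le, ← sub_div, Nat.cast_succ, add_sub_cancel_left, one_div]
  have hle : l ≤ r := Subtype.coe_le_coe.1 (sub_nonneg.1 (by rw [hlr]; positivity))
  have hvar : Var[√2 ^ (n + 2) • (B m - (2⁻¹ : ℝ) • (B l + B r)); P] = 1 := by
    rw [variance_smul, hB.variance_secondDifference hle (coe_dyadic_midpoint hj), hlr,
      ← two_pow_eq_sqrt_two_pow_sq, pow_add]
    field_simp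
    norm_num
  have hmean : P[√2 ^ (n + 2) • (B m - (2⁻¹ : ℝ) • (B l + B r))] = 0 := by
    simp only [Pi.smul_apply, integral_smul, hB.integral_secondDifference, smul_zero]
  have hZ := hasSubgaussianMGF_of_hasGaussianLaw
    ((hB.hasGaussianLaw_secondDifference l m r).smul (√2 ^ (n + 2))) hmean
  rw [hvar, Real.toNNReal_one] at hZ
  exact hZ.congr (hX.mono fun _ hω => (coefficient_succ_eq hω hj).symm)

end IsLevyCiesielskiExpansion

end BrownianMotion

end GBM

end

theorem theorem1_general (r σ : ℝ) (c : NNReal) :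
    ∃ C : ℝ, 0 < C ∧
      ∀ (Ω : Type*) [MeasurableSpace Ω] (P : Measure Ω)
        (B : unitInterval → Ω → ℝ) (X₀ : Ω → ℝ) (X : ℕ → ℕ → Ω → ℝ),
        HasSubgaussianMGF X₀ c P →
        (∀ n, ∀ i ∈ Finset.Icc 1 (2 ^ n), HasSubgaussianMGF (X (n + 1) i) c P) →
        GBM.IsLevyCiesielskiExpansion X₀ X B P →
        ∀ (S₀ : ℝ) (N : ℕ), 1 ≤ N →
          Integrable (GBM.uniformError S₀ r σ B X₀ X N) P ∧
          ∫ ω, GBM.uniformError S₀ r σ B X₀ X N ω ∂P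
            ≤ C * |S₀| * (Real.sqrt N / (2 : ℝ) ^ ((N : ℝ) / 2)) ∧
          ∫ ω, GBM.uniformError S₀ r σ B X₀ X N ω ∂P
            ≤ C * |S₀| * Real.sqrt (Real.log ((2 : ℝ) ^ N) / (2 : ℝ) ^ N) := by
  have hA := GBM.errorConst_pos r σ c
  have hlog : 0 < √(Real.log 2) := Real.sqrt_pos.2 (Real.log_pos one_lt_two)
  have hlog' : 1 ≤ (√(Real.log 2))⁻¹ := by
    rw [one_le_inv₀ hlog, Real.sqrt_le_one]
    linarith [Real.log_two_lt_d9]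
  refine ⟨GBM.errorConst r σ c * (√(Real.log 2))⁻¹, by positivity, ?_⟩
  intro Ω _ P B X₀ X h₀ h hX S₀ N hN
  obtain ⟨hint, hle⟩ := GBM.integrable_uniformError_and_integral_le h₀ h hX S₀ r σ hN
  refine ⟨hint, hle.trans ?_, hle.trans_eq ?_⟩
  · gcongr
    exact le_mul_of_one_le_right hA.le hlog'
  · rw [GBM.sqrt_div_two_rpow_eq]
    ring

theorem theorem1 (r σ : ℝ) :
    ∃ C : ℝ, 0 < C ∧
      ∀ (Ω : Type*) [MeasurableSpace Ω] (P : Measure Ω) [IsProbabilityMeasure P]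
        (B : unitInterval → Ω → ℝ) (X₀ : Ω → ℝ) (X : ℕ → ℕ → Ω → ℝ),
        GBM.IsStandardBrownianMotion B P →
        GBM.IsLevyCiesielskiExpansion X₀ X B P →
        ∀ (S₀ : ℝ) (N : ℕ), 1 ≤ N →
          Integrable (GBM.uniformError S₀ r σ B X₀ X N) P ∧
          ∫ ω, GBM.uniformError S₀ r σ B X₀ X N ω ∂P
            ≤ C * |S₀| * (Real.sqrt N / (2 : ℝ) ^ ((N : ℝ) / 2)) ∧
          ∫ ω, GBM.uniformError S₀ r σ B X₀ X N ω ∂P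
            ≤ C * |S₀| * Real.sqrt (Real.log ((2 : ℝ) ^ N) / (2 : ℝ) ^ N) := by
  obtain ⟨C, hC, h⟩ := theorem1_general r σ 1
  exact ⟨C, hC, fun Ω _ P _ B X₀ X hB hX =>
    h Ω P B X₀ X (hX.hasSubgaussianMGF_zero hB) (hX.hasSubgaussianMGF_succ hB) hX⟩
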